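/- Let $S^2\subset\mathbb{R}^3$ be the round unit sphere with Riemannian distance $d$, and let $SO(3)$ act on $S^2$ by rotations and diagonally on $(S^2)^N$, $N\ge 1$. A *diagonal $G$-space* is an open dense subset of $(S^2)^N$ invariant under the diagonal action. A *jointly radial function* is a real analytic function $\varphi:D_\varphi\to\mathbb{R}$ on a diagonal $G$-space $D_\varphi$ that is constant on the orbits of the diagonal action. A *population dynamics* (PD) is a real analytic vector field $F=(F_1,\dots,F_N)$, $F_i(X)\in T_{X_i}S^2$, on a diagonal $G$-space $D_F$, such that $F_i(gX_1,\dots,gX_N)=g\,F_i(X_1,\dots,X_N)$ for all $g\in SO(3)$, $X\in D_F$ and $i$, and such that $F$ has no extension to an analytic vector field on a strictly larger diagonal $G$-space (its domain is maximal). For $a,b\in S^2$ at which $d(\cdot,b)$ is differentiable at $a$, let $h(a,b)\in T_aS^2$ be the Riemannian gradient at $a$ of $d(\cdot,b)$, i.e. the component on the first variable of the gradient of $d$ at $(a,b)$, and let $h^\perp(a,b)=a\times h(a,b)$ be its rotation by a right angle in $T_aS^2$. Then: 1. For $N=1$, the only PD is the null vector field, with domain $S^2$. 2. For $N=2$, an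 analytic vector field $F$ with maximal domain on a diagonal $G$-space is a PD if and only if for each $i\in\{1,2\}$, with $j$ the other index, there are jointly radial functions $\varphi_{i,1},\varphi_{i,2}$ such that, at every point $X$ common to the domains of $F,\varphi_{i,1},\varphi_{i,2}$ (an open dense set), $h(X_i,X_j)$ exists and $$F_i(X)=\varphi_{i,1}(X)\,h(X_i,X_j)+\varphi_{i,2}(X)\,h^\perp(X_i,X_j).$$ 3. For $N\ge 3$, choose for each $i\in\{1,\dots,N\}$ three distinct indices $k_1=i,\ k_2=k_2(i),\ k_3=k_3(i)$. An analytic vector field $F$ with maximal domain on a diagonal $G$-space is a PD if and only if for each $i$ there are jointly radial functions $\varphi_{i,1},\varphi_{i,2}$ such that, at every point $X$ common to the domains of $F,\varphi_{i,1},\varphi_{i,2}$, the gradients $h(X_{k_1},X_{k_2})$ and $h(X_{k_1},X_{k_3})$ exist and $$F_i(X)=\varphi_{i,1}(X)\,h(X_{k_1},X_{k_2})+\varphi_{i,2}(X)\,h(X_{k_1},X_{k_3}).$$ -/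

import Mathlib

open Metric Set
open scoped Manifold ContDiff Matrix

noncomputable section

namespace SphereDynamics

/-- Euclidean three-space. -/
abbrev E3 : Type := EuclideanSpace ℝ (Fin 3)

/-- The unit sphere in `ℝ³`, with the analytic manifold structure of Mathlib. -/
abbrev S2 : Type := sphere (0 : E3) 1

/-- The rotation group. -/
abbrev SO3 : Type := Matrix.specialOrthogonalGroup (Fin 3) ℝ

/-- The linear action of a rotation on `ℝ³`. Restricted to the plane `x^⊥ = T_x S²`, it is the
tangent map at `x` of the action on the sphere. -/
def rotLin (g : SO3) : E3 →ₗ[ℝ] E3 := Matrix.toEuclideanLin (g : Matrix (Fin 3) (Fin 3) ℝ)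

theorem norm_rotLin (g : SO3) (x : E3) : ‖rotLin g x‖ = ‖x‖ := by
  have hg : (g : Matrix (Fin 3) (Fin 3) ℝ)ᵀ * (g : Matrix (Fin 3) (Fin 3) ℝ) = 1 :=
    (Matrix.mem_orthogonalGroup_iff' (Fin 3) ℝ).1
      (Matrix.mem_specialOrthogonalGroup_iff.1 g.2).1
  have h : ‖rotLin g x‖ ^ 2 = ‖x‖ ^ 2 := by
    rw [← real_inner_self_eq_norm_sq, ← real_inner_self_eq_norm_sq,
      EuclideanSpace.inner_eq_star_dotProduct, EuclideanSpace.inner_eq_star_dotProduct]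
    simp only [rotLin, Matrix.toEuclideanLin, Matrix.ofLp_toLpLin, Matrix.toLin'_apply, star_trivial]
    rw [Matrix.dotProduct_mulVec, Matrix.vecMul_mulVec, hg, Matrix.vecMul_one]
  exact (sq_eq_sq₀ (norm_nonneg _) (norm_nonneg _)).1 h

/-- The action of `SO(3)` on the sphere. -/
def rot (g : SO3) (x : S2) : S2 :=
  ⟨rotLin g x, by rw [mem_sphere_zero_iff_norm, norm_rotLin]; exact mem_sphere_zero_iff_norm.1 x.2⟩

/-- The product manifold `(S²)^N`. -/
abbrev Conf (N : ℕ) : Type := Fin N → S2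

/-- The diagonal action of `SO(3)` on `(S²)^N`. -/
def diagRot {N : ℕ} (g : SO3) (X : Conf N) : Conf N := fun i => rot g (X i)

/-- Open dense subsets of `(S²)^N` that are invariant under the diagonal action. -/
structure IsDiagonalGSpace {N : ℕ} (D : Set (Conf N)) : Prop where
  isOpen : IsOpen D
  dense : Dense D
  invariant : ∀ g : SO3, ∀ X ∈ D, diagRot g X ∈ D

/-- Analyticity on a subset of the product manifold `(S²)^N`, for maps into a normed space. -/
def AnalyticOnConf {N : ℕ} {V : Type*} [NormedAddCommGroup V] [NormedSpace ℝ V]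
    (f : Conf N → V) (D : Set (Conf N)) : Prop :=
  ContMDiffOn (ModelWithCorners.pi fun _ : Fin N => 𝓡 2) 𝓘(ℝ, V) ω f D

/-- Jointly radial functions: analytic functions on an open dense diagonal `SO(3)`-space, constant
on the orbits of the diagonal action. Values outside `dom` are irrelevant. -/
structure JointlyRadial (N : ℕ) where
  dom : Set (Conf N)
  toFun : Conf N → ℝ
  isDiagonalGSpace : IsDiagonalGSpace dom
  analytic : AnalyticOnConf toFun dom
  radial : ∀ g : SO3, ∀ X ∈ dom, toFun (diagRot g X) = toFun X

/-- Analytic vector fields on an open dense diagonal `SO(3)`-space in `(S²)^N`. The component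
`toFun X i` is a vector of `ℝ³` lying in `T_{X i} S² = (X i)^⊥`. Values outside `dom` are
irrelevant. -/
structure ConfVectorField (N : ℕ) where
  dom : Set (Conf N)
  toFun : Conf N → Fin N → E3
  isDiagonalGSpace : IsDiagonalGSpace dom
  tangent : ∀ X ∈ dom, ∀ i, inner ℝ (X i : E3) (toFun X i) = 0
  analytic : AnalyticOnConf toFun dom

namespace ConfVectorField

variable {N : ℕ}

/-- Equivariance of each component with respect to the diagonal action. -/
def IsEquivariant (F : ConfVectorField N) : Prop :=
  ∀ g : SO3, ∀ X ∈ F.dom, ∀ i, F.toFun (diagRot g X) i = rotLin g (F.toFun X i)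

/-- The field has no analytic extension to a strictly larger diagonal `SO(3)`-space. -/
def HasMaximalDomain (F : ConfVectorField N) : Prop :=
  ¬ ∃ F' : ConfVectorField N, F.dom ⊂ F'.dom ∧ ∀ X ∈ F.dom, F'.toFun X = F.toFun X

/-- Population dynamics of `N` agents on `S²` with symmetry group `SO(3)`: the members of the
family of population dynamics of `(N, S², SO(3))`. -/
def IsPopulationDynamics (F : ConfVectorField N) : Prop :=
  F.IsEquivariant ∧ F.HasMaximalDomain

end ConfVectorField

/-- The differential at `x` of the inclusion of the sphere in `ℝ³`. -/
def inclDeriv (x : S2) : TangentSpace (𝓡 2) x →L[ℝ] E3 :=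
  mvfderiv (𝓡 2) (Subtype.val : S2 → E3) x

/-- The norm of the round Riemannian metric, i.e. the one induced by the inclusion in `ℝ³`. -/
@[reducible]
def roundENorm (x : S2) : ENorm (TangentSpace (𝓡 2) x) := ⟨fun w => ‖inclDeriv x w‖ₑ⟩

/-- The Riemannian distance of the round sphere: the infimum of the lengths of `C¹` paths. -/
def sphereDist (x y : S2) : ℝ :=
  letI := roundENorm
  (Manifold.riemannianEDist (𝓡 2) x y).toReal

/-- The distance function `d(·, b)` is differentiable at `a`, and `v ∈ T_a S² = a^⊥ ⊂ ℝ³` is its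
Riemannian gradient there: the component on the first variable of the gradient of `d` at
`(a, b)`. -/
def IsDistGradient (a b : S2) (v : E3) : Prop :=
  inner ℝ (a : E3) v = 0 ∧
  MDifferentiableAt (𝓡 2) 𝓘(ℝ, ℝ) (fun y : S2 => sphereDist y b) a ∧
  ∀ w : TangentSpace (𝓡 2) a,
    mvfderiv (𝓡 2) (fun y : S2 => sphereDist y b) a w = inner ℝ v (inclDeriv a w)

/-- The rotation `v ↦ a × v` by a right angle in the tangent plane `T_a S² = a^⊥`. -/
def perp (a : S2) (v : E3) : E3 :=
  WithLp.toLp 2 (crossProduct (WithLp.ofLp (a : E3)) (WithLp.ofLp v))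

end SphereDynamics

end

noncomputable section

namespace SphereDynamics

open Filter Topology MeasureTheory InnerProductGeometry

/-! ### The Riemannian distance of the round sphere -/

section Angle

variable {V : Type*} [NormedAddCommGroup V] [InnerProductSpace ℝ V]

/-! For non-collinear points the Riemannian distance is `arccos ⟨x, y⟩`: no curve on the sphere is
shorter than the angle it spans (`angle_le_riemannianEDist`), and a great circle arc attains it. The
gradient is therefore the explicit vector `distGradient`, and the existential in the statement
leaves no freedom (`isDistGradient_iff`). Both `distGradient` and the cross product commute with
rotations.

Hence on an invariant open dense set of configurations in general position, `h, a × h` (or, with a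
third agent, two gradients) form a frame of the tangent plane that rotates with the configuration.
The coefficients of an equivariant field in this frame are invariant, and formulas of Cramer type
(`eq_distGradient_add_cross`, `eq_distGradient_add_distGradient`) show that they are analytic.
Conversely, an invariant combination of these vectors is equivariant on a dense set, hence on the
whole domain by continuity (`equivariant_of_inter`). Maximality of the domain is carried along
unchanged.

A single agent has no frame. Transitivity of the action makes the domain the whole sphere, and the
half turn about the agent's position fixes it while negating its tangent plane, so the field
vanishes. -/

theorem angle_eq_two_mul_arcsin {u v : V} (hu : ‖u‖ = 1) (hv : ‖v‖ = 1) :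
    angle u v = 2 * Real.arcsin (‖v - u‖ / 2) := by
  have h0 := angle_nonneg u v
  have h1 := angle_le_pi u v
  have hs : 0 ≤ Real.sin (angle u v / 2) :=
    Real.sin_nonneg_of_nonneg_of_le_pi (by linarith) (by linarith)
  have hcos : inner ℝ u v = Real.cos (angle u v) := by
    rw [cos_angle, hu, hv]; simp
  have hsq : ‖v - u‖ ^ 2 = (2 * Real.sin (angle u v / 2)) ^ 2 := by
    have h2 : Real.cos (angle u v) = 1 - 2 * Real.sin (angle u v / 2) ^ 2 := by
      have := Real.cos_two_mul (angle u v / 2)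
      rw [mul_div_cancel₀ _ two_ne_zero] at this
      rw [this, Real.cos_sq']; ring
    rw [norm_sub_sq_real, real_inner_comm, hcos, hu, hv, h2]; ring
  have h3 : ‖v - u‖ = 2 * Real.sin (angle u v / 2) :=
    (sq_eq_sq₀ (norm_nonneg _) (by positivity)).1 hsq
  rw [h3, mul_div_cancel_left₀ _ two_ne_zero, Real.arcsin_sin (by linarith) (by linarith)]
  ring

/-- The angle between two unit vectors is at most the length of a curve on the unit sphere that
joins them. -/
theorem angle_le_integral_norm_deriv {c : ℝ → V} (hc : ContDiff ℝ 1 c) (h1 : ∀ t, ‖c t‖ = 1)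
    {a b : ℝ} (hab : a ≤ b) : angle (c a) (c b) ≤ ∫ t in a..b, ‖deriv c t‖ := by
  have hne : ∀ t, c t ≠ 0 := fun t h => by simpa [h] using h1 t
  have hd : Continuous fun t => ‖deriv c t‖ := (hc.continuous_deriv le_rfl).norm
  have hB : ∀ x, HasDerivAt (fun t => ∫ s in a..t, ‖deriv c s‖) ‖deriv c x‖ x := fun x =>
    intervalIntegral.integral_hasDerivAt_right (hd.intervalIntegrable _ _)
      (hd.stronglyMeasurableAtFilter _ _) hd.continuousAt
  -- Angle and chord agree to first order, so the growth of the angle is controlled by the speed in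
  -- the ambient space.
  have hk : HasDerivAt (fun s : ℝ => 2 * Real.arcsin (s / 2)) 1 0 := by
    have h := ((Real.hasDerivAt_arcsin (x := (0 : ℝ) / 2) (by norm_num) (by norm_num)).comp
      (0 : ℝ) ((hasDerivAt_id (0 : ℝ)).div_const 2)).const_mul 2
    simpa using h
  refine image_le_of_liminf_slope_right_le_deriv_boundary (f := fun t => angle (c a) (c t))
    (B := fun t => ∫ s in a..t, ‖deriv c s‖) (B' := fun t => ‖deriv c t‖) ?_ ?_ ?_ ?_ ?_
    (right_mem_Icc.2 hab)
  · intro t _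
    exact ((continuousAt_angle (x := (c a, c t)) (hne a) (hne t)).comp
      (f := fun t => (c a, c t))
      (continuousAt_const.prodMk hc.continuous.continuousAt)).continuousWithinAt
  · simp [angle_self (hne a)]
  · exact fun t _ => (hB t).continuousAt.continuousWithinAt
  · exact fun t _ => (hB t).hasDerivWithinAt
  · intro x _ r hr
    refine Eventually.frequently ?_
    set m := ‖deriv c x‖ with hm
    have hm0 : 0 ≤ m := norm_nonneg _
    -- The relative error must keep `(1 + ε) * m` below `r`; the summand `1` covers a vanishing
    -- speed.
    set ε := (r - m) / (2 * (m + 1)) with hε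
    have hε0 : 0 < ε := div_pos (by linarith) (by linarith)
    have hlt : (1 + ε) * m < r := by
      have : ε * (2 * (m + 1)) = r - m := div_mul_cancel₀ _ (by linarith)
      nlinarith
    have hcx : HasDerivAt c (deriv c x) x :=
      (hc.differentiable one_ne_zero x).hasDerivAt
    have hsl : ∀ᶠ z in 𝓝[>] x, (1 + ε) * ‖slope c x z‖ < r := by
      have h := ((hasDerivAt_iff_tendsto_slope.1 hcx).norm.const_mul (1 + ε)).eventually_lt_const hlt
      exact h.filter_mono (nhdsWithin_mono _ fun z hz => ne_of_gt hz)
    have hsmall : ∀ᶠ z in 𝓝[>] x, 2 * Real.arcsin (‖c z - c x‖ / 2) ≤ (1 + ε) * ‖c z - c x‖ := by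
      have h0 : ∀ᶠ s in 𝓝 (0 : ℝ), ‖2 * Real.arcsin (s / 2) - s‖ ≤ ε * ‖s‖ := by
        have h := (hasDerivAt_iff_isLittleO.1 hk).def hε0
        simpa using h
      have ht : Tendsto (fun z => ‖c z - c x‖) (𝓝 x) (𝓝 0) := by
        have : Continuous fun z => ‖c z - c x‖ := (hc.continuous.sub continuous_const).norm
        simpa using this.tendsto x
      filter_upwards [(ht.eventually h0).filter_mono nhdsWithin_le_nhds] with z hz
      rw [Real.norm_eq_abs, norm_norm] at hz
      linarith [le_abs_self (2 * Real.arcsin (‖c z - c x‖ / 2) - ‖c z - c x‖)]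
    filter_upwards [hsl, hsmall, self_mem_nhdsWithin] with z h₁ h₂ (hz : x < z)
    have hz' : 0 < z - x := sub_pos.2 hz
    rw [slope_def_field, div_lt_iff₀ hz']
    rw [slope_def_module, norm_smul, norm_inv, Real.norm_of_nonneg hz'.le] at h₁
    have h₃ : (1 + ε) * ‖c z - c x‖ < r * (z - x) := by
      have := mul_lt_mul_of_pos_right h₁ hz'
      rwa [show (1 + ε) * ((z - x)⁻¹ * ‖c z - c x‖) * (z - x) = (1 + ε) * ‖c z - c x‖ by
        field_simp] at this
    have h₄ := angle_le_angle_add_angle (c a) (c x) (c z)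
    rw [angle_eq_two_mul_arcsin (h1 x) (h1 z)] at h₄
    linarith

end Angle

theorem norm_coe_S2 (x : S2) : ‖(x : E3)‖ = 1 := mem_sphere_zero_iff_norm.1 x.2

theorem finrank_E3 : Fact (Module.finrank ℝ E3 = 2 + 1) := ⟨finrank_euclideanSpace_fin⟩

theorem contMDiff_coe_S2 {m : ℕ∞ω} : ContMDiff (𝓡 2) 𝓘(ℝ, E3) m (Subtype.val : S2 → E3) :=
  haveI := finrank_E3
  contMDiff_coe_sphere

theorem mdifferentiableAt_coe_S2 (x : S2) :
    MDifferentiableAt (𝓡 2) 𝓘(ℝ, E3) (Subtype.val : S2 → E3) x :=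
  (contMDiff_coe_S2 (m := 1) x).mdifferentiableAt one_ne_zero

theorem inclDeriv_mfderiv_apply {γ : ℝ → S2} {t : ℝ}
    (hγ : MDifferentiableAt 𝓘(ℝ, ℝ) (𝓡 2) γ t) :
    inclDeriv (γ t) (mfderiv 𝓘(ℝ, ℝ) (𝓡 2) γ t 1) = deriv (fun s => (γ s : E3)) t := by
  have h := mfderiv_comp t (mdifferentiableAt_coe_S2 (γ t)) hγ
  rw [mfderiv_eq_fderiv] at h
  exact (congrArg (fun L => L (1 : ℝ)) h).symm

theorem pathELength_eq_lintegral_deriv {γ : ℝ → S2} (hγ : MDifferentiable 𝓘(ℝ, ℝ) (𝓡 2) γ)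
    (a b : ℝ) :
    letI := roundENorm
    Manifold.pathELength (𝓡 2) γ a b = ∫⁻ t in Icc a b, ‖deriv (fun s => (γ s : E3)) t‖ₑ := by
  let := roundENorm
  rw [Manifold.pathELength_eq_lintegral_mfderiv_Icc]
  refine lintegral_congr fun t => ?_
  rw [← inclDeriv_mfderiv_apply (hγ t)]
  rfl

/-- Homogeneity of the norms is the instance that the general facts on Riemannian length need below.
-/
theorem enormSMulClass_round (x : S2) :
    letI := roundENorm
    ENormSMulClass ℝ (TangentSpace (𝓡 2) x) := by
  let := roundENorm
  refine ⟨fun r w => ?_⟩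
  change ‖inclDeriv x (r • w)‖ₑ = ‖r‖ₑ * ‖inclDeriv x w‖ₑ
  rw [map_smul, enorm_smul]

theorem angle_le_riemannianEDist (x y : S2) :
    letI := roundENorm
    ENNReal.ofReal (angle (x : E3) y) ≤ Manifold.riemannianEDist (𝓡 2) x y := by
  let := roundENorm
  have := enormSMulClass_round
  refine le_of_forall_gt fun r hr => ?_
  -- This path is C¹ on all of `ℝ`, so its length is an integral of an ordinary derivative.
  obtain ⟨γ, h0, h1, hγ, hlt, -⟩ :=
    Manifold.exists_lt_locally_constant_of_riemannianEDist_lt hr zero_lt_one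
  have hc : ContDiff ℝ 1 (fun s => (γ s : E3)) :=
    contMDiff_iff_contDiff.1 (contMDiff_coe_S2.comp hγ)
  have hint : Continuous fun t => ‖deriv (fun s => (γ s : E3)) t‖ :=
    (hc.continuous_deriv le_rfl).norm
  refine lt_of_le_of_lt ?_ hlt
  rw [pathELength_eq_lintegral_deriv (hγ.mdifferentiable one_ne_zero)]
  have h := angle_le_integral_norm_deriv hc (fun t => norm_coe_S2 (γ t)) zero_le_one
  rw [h0, h1] at h
  refine (ENNReal.ofReal_le_ofReal h).trans_eq ?_
  rw [intervalIntegral.integral_of_le zero_le_one, ← integral_Icc_eq_integral_Ioc,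
    ofReal_integral_eq_lintegral_ofReal hint.integrableOn_Icc (ae_of_all _ fun _ => norm_nonneg _)]
  exact lintegral_congr fun t => ofReal_norm _

/-- A great circle arc of angular length `θ` has length `θ`. -/
theorem riemannianEDist_le_of_eq_cos_add_sin {x y : S2} {u : E3} (hu : ‖u‖ = 1)
    (hxu : inner ℝ (x : E3) u = 0) {θ : ℝ} (hθ : 0 ≤ θ)
    (hy : (y : E3) = Real.cos θ • (x : E3) + Real.sin θ • u) :
    letI := roundENorm
    Manifold.riemannianEDist (𝓡 2) x y ≤ ENNReal.ofReal θ := by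
  let := roundENorm
  have := enormSMulClass_round
  have hnorm : ∀ p q : ℝ, p ^ 2 + q ^ 2 = 1 → ‖p • (x : E3) + q • u‖ = 1 := by
    intro p q hpq
    have h : ‖p • (x : E3) + q • u‖ ^ 2 = 1 := by
      rw [norm_add_sq_real, norm_smul, norm_smul, norm_coe_S2, hu, real_inner_smul_left,
        real_inner_smul_right, hxu]
      simpa using hpq
    exact (pow_eq_one_iff_of_nonneg (norm_nonneg _) two_ne_zero).1 h
  let c : ℝ → E3 := fun t => Real.cos t • (x : E3) + Real.sin t • u
  have hcS : ∀ t, c t ∈ sphere (0 : E3) 1 := fun t =>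
    mem_sphere_zero_iff_norm.2 (hnorm _ _ (Real.cos_sq_add_sin_sq t))
  have hc : ContDiff ℝ 1 c := by fun_prop
  have hγ : ContMDiff 𝓘(ℝ, ℝ) (𝓡 2) 1 (codRestrict c _ hcS) :=
    haveI := finrank_E3
    hc.contMDiff.codRestrict_sphere hcS
  have hder : ∀ t, ‖deriv c t‖ = 1 := by
    intro t
    have h : HasDerivAt c ((-Real.sin t) • (x : E3) + Real.cos t • u) t :=
      ((Real.hasDerivAt_cos t).smul_const _).add ((Real.hasDerivAt_sin t).smul_const _)
    rw [h.deriv]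
    exact hnorm _ _ (by rw [neg_sq]; exact Real.sin_sq_add_cos_sq t)
  have h := Manifold.riemannianEDist_le_pathELength (I := 𝓡 2) (x := x) (y := y) (a := 0) (b := θ)
    hγ.contMDiffOn (Subtype.ext (by simp [c])) (Subtype.ext (by simp [c, hy])) hθ
  refine h.trans_eq ?_
  rw [pathELength_eq_lintegral_deriv (hγ.mdifferentiable one_ne_zero)]
  have h1 : ∀ t, ‖deriv (fun s => (codRestrict c _ hcS s : E3)) t‖ₑ = 1 := by
    intro t
    change ‖deriv c t‖ₑ = 1
    rw [← ofReal_norm, hder, ENNReal.ofReal_one]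
  simp_rw [h1]
  simp

/-- The spherical distance between two points that are not collinear. -/
theorem sphereDist_eq_arccos {x y : S2} (h : inner ℝ (x : E3) y ^ 2 < 1) :
    sphereDist x y = Real.arccos (inner ℝ (x : E3) y) := by
  set p : ℝ := inner ℝ (x : E3) y with hp
  have hang : angle (x : E3) y = Real.arccos p := by
    simp [angle, hp]
  have hp1 : -1 ≤ p ∧ p ≤ 1 := abs_le.1 ((sq_lt_one_iff_abs_lt_one p).1 h).le
  have hs : 0 < √(1 - p ^ 2) := Real.sqrt_pos.2 (by linarith)
  -- The direction is the normalised component of `y` orthogonal to `x`; its norm `√(1 - p ^ 2)` is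
  -- nonzero because the points are not collinear.
  have hle := riemannianEDist_le_of_eq_cos_add_sin (x := x) (y := y)
    (u := (√(1 - p ^ 2))⁻¹ • ((y : E3) - p • (x : E3))) ?_ ?_ (Real.arccos_nonneg p) ?_
  · rw [sphereDist, le_antisymm hle (by rw [← hang]; exact angle_le_riemannianEDist x y),
      ENNReal.toReal_ofReal (Real.arccos_nonneg p)]
  · have h2 : ‖(y : E3) - p • (x : E3)‖ ^ 2 = √(1 - p ^ 2) ^ 2 := by
      rw [norm_sub_sq_real, norm_smul, real_inner_smul_right, real_inner_comm, ← hp, norm_coe_S2,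
        norm_coe_S2, Real.sq_sqrt (by linarith), Real.norm_eq_abs, mul_one, sq_abs]
      ring
    rw [norm_smul, (sq_eq_sq₀ (norm_nonneg _) hs.le).1 h2, norm_inv, Real.norm_of_nonneg hs.le,
      inv_mul_cancel₀ hs.ne']
  · rw [real_inner_smul_right, inner_sub_right, real_inner_smul_right,
      real_inner_self_eq_norm_sq, norm_coe_S2, ← hp]
    simp
  · rw [Real.cos_arccos hp1.1 hp1.2, Real.sin_arccos, smul_smul, mul_inv_cancel₀ hs.ne', one_smul]
    abel

/-! ### The gradient of the distance -/

/-- The gradient at `a` of the distance to `b`. -/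
def distGradient (a b : E3) : E3 :=
  -(√(1 - inner ℝ a b ^ 2))⁻¹ • (b - inner ℝ a b • a)

theorem hasMFDerivAt_sphereDist {a b : S2} (h : inner ℝ (a : E3) b ^ 2 < 1) :
    MDifferentiableAt (𝓡 2) 𝓘(ℝ, ℝ) (fun y : S2 => sphereDist y b) a ∧
    ∀ w : TangentSpace (𝓡 2) a, mvfderiv (𝓡 2) (fun y : S2 => sphereDist y b) a w =
      -(√(1 - inner ℝ (a : E3) b ^ 2))⁻¹ * inner ℝ (b : E3) (inclDeriv a w) := by
  have hp1 := abs_lt.1 ((sq_lt_one_iff_abs_lt_one _).1 h)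
  let G : E3 → ℝ := fun z => Real.arccos (inner ℝ z (b : E3))
  have hin : HasFDerivAt (fun z : E3 => inner ℝ z (b : E3)) (innerSL ℝ (b : E3)) (a : E3) := by
    have := (innerSL ℝ (b : E3)).hasFDerivAt (x := (a : E3))
    refine this.congr_of_eventuallyEq (Eventually.of_forall fun z => ?_)
    simp [real_inner_comm]
  have hG : HasFDerivAt G (-(1 / √(1 - inner ℝ (a : E3) b ^ 2)) • innerSL ℝ (b : E3)) (a : E3) :=
    HasDerivAt.comp_hasFDerivAt (h₂ := Real.arccos) (f := fun z : E3 => inner ℝ z (b : E3)) (a : E3)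
      (Real.hasDerivAt_arccos hp1.1.ne' hp1.2.ne) hin
  have hcomp := hG.hasMFDerivAt.comp a (mdifferentiableAt_coe_S2 a).hasMFDerivAt
  -- Non-collinearity with `b` is an open condition, so the arccosine formula holds near `a`, which
  -- is enough for the derivative.
  have hev : (fun y : S2 => sphereDist y b) =ᶠ[𝓝 a] G ∘ Subtype.val := by
    have hc : Continuous fun y : S2 => inner ℝ (y : E3) b ^ 2 := by fun_prop
    filter_upwards [hc.continuousAt.eventually_lt_const h] with y hy
    exact sphereDist_eq_arccos hy
  have hd := hcomp.congr_of_eventuallyEq hev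
  refine ⟨hd.mdifferentiableAt, fun w => ?_⟩
  have := congrArg (fun L => L w) hd.mfderiv
  refine this.trans ?_
  rw [← one_div]
  rfl

theorem range_inclDeriv (a : S2) : (inclDeriv a).range = (Submodule.span ℝ {(a : E3)})ᗮ :=
  haveI := finrank_E3
  range_mvfderiv_subtypeVal a

theorem inner_distGradient_self (a : S2) (b : E3) : inner ℝ (a : E3) (distGradient a b) = 0 := by
  rw [distGradient, real_inner_smul_right, inner_sub_right, real_inner_smul_right,
    real_inner_self_eq_norm_sq, norm_coe_S2]
  simp

/-- Two candidates differ by a tangent vector, which lies in the range of `inclDeriv a`; testing the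
difference against itself gives zero. -/
theorem isDistGradient_iff {a b : S2} (h : inner ℝ (a : E3) b ^ 2 < 1) (v : E3) :
    IsDistGradient a b v ↔ v = distGradient a b := by
  obtain ⟨hd, hf⟩ := hasMFDerivAt_sphereDist h
  have hw : ∀ w : TangentSpace (𝓡 2) a, inner ℝ (a : E3) (inclDeriv a w) = 0 := fun w =>
    Submodule.mem_orthogonal_singleton_iff_inner_right.1
      (range_inclDeriv a ▸ LinearMap.mem_range_self _ w)
  have hg : ∀ w : TangentSpace (𝓡 2) a, inner ℝ (distGradient a b) (inclDeriv a w) =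
      -(√(1 - inner ℝ (a : E3) b ^ 2))⁻¹ * inner ℝ (b : E3) (inclDeriv a w) := by
    intro w
    rw [distGradient, real_inner_smul_left, inner_sub_left, real_inner_smul_left, hw]
    ring
  constructor
  · rintro ⟨hv, -, hv'⟩
    have hmem : v - distGradient a b ∈ (inclDeriv a).range := by
      rw [range_inclDeriv, Submodule.mem_orthogonal_singleton_iff_inner_right, inner_sub_right, hv,
        inner_distGradient_self, sub_zero]
    obtain ⟨w, hw'⟩ := hmem
    refine sub_eq_zero.1 (inner_self_eq_zero (𝕜 := ℝ).1 ?_)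
    nth_rw 2 [← hw']
    rw [inner_sub_left]
    exact sub_eq_zero.2 ((hv' w).symm.trans ((hf w).trans (hg w).symm))
  · rintro rfl
    exact ⟨inner_distGradient_self a b, hd, fun w => (hf w).trans (hg w).symm⟩

/-! ### Cross product and rotations -/

/-- The cross product of `ℝ³`. -/
def cross (a b : E3) : E3 :=
  WithLp.toLp 2 (crossProduct (WithLp.ofLp a) (WithLp.ofLp b))

theorem perp_eq_cross (a : S2) (v : E3) : perp a v = cross a v := rfl

theorem cross_apply_zero (a b : E3) : cross a b 0 = a 1 * b 2 - a 2 * b 1 := by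
  simp [cross, cross_apply]

theorem cross_apply_one (a b : E3) : cross a b 1 = a 2 * b 0 - a 0 * b 2 := by
  simp [cross, cross_apply]

theorem cross_apply_two (a b : E3) : cross a b 2 = a 0 * b 1 - a 1 * b 0 := by
  simp [cross, cross_apply]

theorem inner_E3 (a b : E3) : inner ℝ a b = a 0 * b 0 + a 1 * b 1 + a 2 * b 2 := by
  simp [PiLp.inner_apply, Fin.sum_univ_three, mul_comm]

theorem ext_E3 {a b : E3} (h0 : a 0 = b 0) (h1 : a 1 = b 1) (h2 : a 2 = b 2) : a = b := by
  ext i; fin_cases i <;> assumption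

theorem inner_cross_self_left (a b : E3) : inner ℝ a (cross a b) = 0 := by
  rw [inner_E3, cross_apply_zero, cross_apply_one, cross_apply_two]; ring

theorem inner_cross_self_right (a b : E3) : inner ℝ b (cross a b) = 0 := by
  rw [inner_E3, cross_apply_zero, cross_apply_one, cross_apply_two]; ring

theorem inner_cross_swap (a b c : E3) : inner ℝ b (cross a c) = -inner ℝ c (cross a b) := by
  simp only [inner_E3, cross_apply_zero, cross_apply_one, cross_apply_two]; ring

theorem cross_smul_right (a b : E3) (r : ℝ) : cross a (r • b) = r • cross a b := by
  simp [cross]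

theorem cross_sub_right (a b c : E3) : cross a (b - c) = cross a b - cross a c := by
  simp [cross]

theorem cross_self_E3 (a : E3) : cross a a = 0 := by simp [cross]

theorem inner_cross_cross_self (a b : E3) :
    inner ℝ (cross a b) (cross a b) = ‖a‖ ^ 2 * ‖b‖ ^ 2 - inner ℝ a b ^ 2 := by
  rw [← real_inner_self_eq_norm_sq, ← real_inner_self_eq_norm_sq]
  simp only [inner_E3, cross_apply_zero, cross_apply_one, cross_apply_two]; ring

/-- Lagrange's identity links the condition that makes `arccos` and the square root analytic to the
one whose openness, density and invariance are easy to see. -/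
theorem inner_sq_lt_one_iff {a b : S2} :
    inner ℝ (a : E3) b ^ 2 < 1 ↔ cross (a : E3) b ≠ 0 := by
  rw [← real_inner_self_pos (F := E3), inner_cross_cross_self, norm_coe_S2, norm_coe_S2]
  constructor <;> intro h <;> linarith

/-- A vector orthogonal to three linearly independent vectors vanishes. -/
theorem eq_zero_of_inner_eq_zero {a b c v : E3} (h : inner ℝ c (cross a b) ≠ 0)
    (ha : inner ℝ v a = 0) (hb : inner ℝ v b = 0) (hc : inner ℝ v c = 0) : v = 0 := by
  simp only [inner_E3, cross_apply_zero, cross_apply_one, cross_apply_two] at h ha hb hc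
  refine ext_E3 ?_ ?_ ?_ <;> refine (mul_eq_zero.1 ?_).resolve_right h
  -- Cramer's rule: the triple product times `v` is the combination of `b × c`, `c × a`, `a × b`
  -- with coefficients `⟨v, a⟩`, `⟨v, b⟩`, `⟨v, c⟩`.
  · linear_combination (b 1 * c 2 - b 2 * c 1) * ha + (c 1 * a 2 - c 2 * a 1) * hb
      + (a 1 * b 2 - a 2 * b 1) * hc
  · linear_combination (b 2 * c 0 - b 0 * c 2) * ha + (c 2 * a 0 - c 0 * a 2) * hb
      + (a 2 * b 0 - a 0 * b 2) * hc
  · linear_combination (b 0 * c 1 - b 1 * c 0) * ha + (c 0 * a 1 - c 1 * a 0) * hb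
      + (a 0 * b 1 - a 1 * b 0) * hc

theorem inner_cross_cross_cross (a b c : E3) :
    inner ℝ (cross a c) (cross a (cross a b)) = ‖a‖ ^ 2 * inner ℝ c (cross a b) := by
  rw [← real_inner_self_eq_norm_sq]
  simp only [inner_E3, cross_apply_zero, cross_apply_one, cross_apply_two]; ring

theorem inner_rotLin (g : SO3) (a b : E3) : inner ℝ (rotLin g a) (rotLin g b) = inner ℝ a b :=
  (LinearIsometry.mk (rotLin g) (norm_rotLin g)).inner_map_map a b

theorem rotLin_surjective (g : SO3) : Function.Surjective (rotLin g) :=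
  LinearMap.injective_iff_surjective.1
    (LinearIsometry.mk (rotLin g) (norm_rotLin g)).injective

/-- A linear map multiplies the triple product by its determinant; here the determinant `1` of `g`
enters, not just its orthogonality. -/
theorem inner_cross_rotLin (g : SO3) (a b c : E3) :
    inner ℝ (rotLin g c) (cross (rotLin g a) (rotLin g b)) = inner ℝ c (cross a b) := by
  have hdet : (g : Matrix (Fin 3) (Fin 3) ℝ).det = 1 :=
    (Matrix.mem_specialOrthogonalGroup_iff.1 g.2).2
  rw [Matrix.det_fin_three] at hdet
  have hrot : ∀ (v : E3) (i : Fin 3), rotLin g v i =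
      (g : Matrix (Fin 3) (Fin 3) ℝ) i 0 * v 0 + (g : Matrix (Fin 3) (Fin 3) ℝ) i 1 * v 1 +
        (g : Matrix (Fin 3) (Fin 3) ℝ) i 2 * v 2 := by
    intro v i
    simp [rotLin, Matrix.toEuclideanLin, Matrix.mulVec, dotProduct, Fin.sum_univ_three]
  simp only [inner_E3, cross_apply_zero, cross_apply_one, cross_apply_two, hrot]
  linear_combination (c 0 * (a 1 * b 2 - a 2 * b 1) + c 1 * (a 2 * b 0 - a 0 * b 2)
    + c 2 * (a 0 * b 1 - a 1 * b 0)) * hdet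

theorem cross_rotLin (g : SO3) (a b : E3) :
    cross (rotLin g a) (rotLin g b) = rotLin g (cross a b) := by
  refine ext_inner_left ℝ fun w => ?_
  obtain ⟨w, rfl⟩ := rotLin_surjective g w
  rw [inner_cross_rotLin, inner_rotLin]

theorem coe_rot (g : SO3) (x : S2) : (rot g x : E3) = rotLin g x := rfl

theorem distGradient_rotLin (g : SO3) (a b : E3) :
    distGradient (rotLin g a) (rotLin g b) = rotLin g (distGradient a b) := by
  simp only [distGradient, inner_rotLin, map_smul, map_sub]

theorem continuous_diagRot {N : ℕ} (g : SO3) : Continuous (diagRot g : Conf N → Conf N) := by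
  have : Continuous (rotLin g) := (rotLin g).continuous_of_finiteDimensional
  exact continuous_pi fun i => Continuous.subtype_mk
    (this.comp (continuous_subtype_val.comp (continuous_apply i))) _

/-- The rotation by the angle `π` about the axis of a unit vector. -/
theorem exists_halfTurn (m : S2) :
    ∃ g : SO3, ∀ x : E3, rotLin g x = (2 * inner ℝ (m : E3) x) • (m : E3) - x := by
  have hm : (m : E3) 0 * (m : E3) 0 + (m : E3) 1 * (m : E3) 1 + (m : E3) 2 * (m : E3) 2 = 1 := by
    rw [← inner_E3, real_inner_self_eq_norm_sq, norm_coe_S2, one_pow]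
  -- The matrix `2 m mᵀ - 1`.
  let A : Matrix (Fin 3) (Fin 3) ℝ :=
    Matrix.of fun i j => 2 * (m : E3) i * (m : E3) j - if i = j then 1 else 0
  have hA : A ∈ Matrix.specialOrthogonalGroup (Fin 3) ℝ := by
    rw [Matrix.mem_specialOrthogonalGroup_iff, Matrix.mem_orthogonalGroup_iff]
    constructor
    · ext i j
      rw [Matrix.mul_apply, Fin.sum_univ_three]
      fin_cases i <;> fin_cases j <;> simp [A]
      · linear_combination 4 * (m : E3) 0 * (m : E3) 0 * hm
      · linear_combination 4 * (m : E3) 0 * (m : E3) 1 * hm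
      · linear_combination 4 * (m : E3) 0 * (m : E3) 2 * hm
      · linear_combination 4 * (m : E3) 1 * (m : E3) 0 * hm
      · linear_combination 4 * (m : E3) 1 * (m : E3) 1 * hm
      · linear_combination 4 * (m : E3) 1 * (m : E3) 2 * hm
      · linear_combination 4 * (m : E3) 2 * (m : E3) 0 * hm
      · linear_combination 4 * (m : E3) 2 * (m : E3) 1 * hm
      · linear_combination 4 * (m : E3) 2 * (m : E3) 2 * hm
    · rw [Matrix.det_fin_three]
      simp [A]
      linear_combination 2 * hm
  refine ⟨⟨A, hA⟩, fun x => ?_⟩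
  have hrot : ∀ i : Fin 3, rotLin ⟨A, hA⟩ x i = A i 0 * x 0 + A i 1 * x 1 + A i 2 * x 2 := by
    intro i
    simp [rotLin, Matrix.toEuclideanLin, Matrix.mulVec, dotProduct, Fin.sum_univ_three]
  refine ext_E3 ?_ ?_ ?_ <;> rw [hrot, inner_E3] <;> simp [A] <;> ring

/-- The half turn about the bisector of `a` and `b` exchanges them; antipodal points have no
bisector. -/
theorem exists_rot_eq {a b : S2} (h : (a : E3) + b ≠ 0) : ∃ g : SO3, rot g a = b := by
  have hn : ‖(a : E3) + b‖ ≠ 0 := norm_ne_zero_iff.2 h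
  let m : S2 := ⟨‖(a : E3) + b‖⁻¹ • ((a : E3) + b), by
    rw [mem_sphere_zero_iff_norm, norm_smul, norm_inv, norm_norm, inv_mul_cancel₀ hn]⟩
  obtain ⟨g, hg⟩ := exists_halfTurn m
  refine ⟨g, Subtype.ext ?_⟩
  have hsq : ‖(a : E3) + b‖ ^ 2 = 2 * inner ℝ ((a : E3) + b) a := by
    rw [norm_add_sq_real, inner_add_left, real_inner_self_eq_norm_sq, norm_coe_S2, norm_coe_S2,
      real_inner_comm]
    ring
  rw [coe_rot, hg, real_inner_smul_left, smul_smul,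
    show 2 * (‖(a : E3) + b‖⁻¹ * inner ℝ ((a : E3) + b) a) * ‖(a : E3) + b‖⁻¹ = 1 by
      field_simp; rw [hsq]]
  simp

/-! ### Diagonal spaces of configurations in general position -/

theorem IsDiagonalGSpace.inter {N : ℕ} {D D' : Set (Conf N)} (h : IsDiagonalGSpace D)
    (h' : IsDiagonalGSpace D') : IsDiagonalGSpace (D ∩ D') where
  isOpen := h.isOpen.inter h'.isOpen
  dense := h.dense.inter_of_isOpen_left h'.dense h.isOpen
  invariant g X hX := ⟨h.invariant g X hX.1, h'.invariant g X hX.2⟩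

/-- From a point of the kernel, any displacement along a vector `w` outside the kernel leaves it at
once; rescaling returns to the sphere without re-entering it. -/
theorem dense_setOf_linearMap_ne_zero {W : Type*} [AddCommGroup W] [Module ℝ W] (L : E3 →ₗ[ℝ] W)
    (hL : L ≠ 0) : Dense {u : S2 | L u ≠ 0} := by
  obtain ⟨w, hw⟩ : ∃ w, L w ≠ 0 := by
    by_contra! h
    exact hL (LinearMap.ext h)
  intro u
  by_cases hu : L u ≠ 0
  · exact subset_closure hu
  rw [not_not] at hu
  have hne : ∀ t : ℝ, t ≠ 0 → L ((u : E3) + t • w) ≠ 0 := fun t ht => by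
    rw [map_add, map_smul, hu, zero_add]; exact smul_ne_zero ht hw
  have hne' : ∀ t : ℝ, (u : E3) + t • w ≠ 0 := by
    intro t h
    rcases eq_or_ne t 0 with rfl | ht
    · have := norm_coe_S2 u
      rw [zero_smul, add_zero] at h
      simp [h] at this
    · exact hne t ht (by rw [h, map_zero])
  let p : ℝ → S2 := fun t => ⟨‖(u : E3) + t • w‖⁻¹ • ((u : E3) + t • w), by
    rw [mem_sphere_zero_iff_norm, norm_smul, norm_inv, norm_norm,
      inv_mul_cancel₀ (norm_ne_zero_iff.2 (hne' t))]⟩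
  have hp : Continuous p := by
    have h : Continuous fun t : ℝ => (u : E3) + t • w := by fun_prop
    exact Continuous.subtype_mk ((h.norm.inv₀ fun t => norm_ne_zero_iff.2 (hne' t)).smul h) _
  have hp0 : p 0 = u := Subtype.ext (by simp [p])
  have ht : Tendsto p (𝓝[≠] 0) (𝓝 u) := by
    have := hp.tendsto 0
    rw [hp0] at this
    exact this.mono_left nhdsWithin_le_nhds
  refine mem_closure_of_tendsto ht ?_
  filter_upwards [self_mem_nhdsWithin] with t ht0
  change L (‖(u : E3) + t • w‖⁻¹ • ((u : E3) + t • w)) ≠ 0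
  rw [map_smul]
  exact smul_ne_zero (inv_ne_zero (norm_ne_zero_iff.2 (hne' t))) (hne t ht0)

theorem dense_setOf_cross_ne_zero (a : S2) : Dense {u : S2 | cross (a : E3) u ≠ 0} := by
  let L : E3 →ₗ[ℝ] E3 :=
    { toFun := cross a
      map_add' := fun x y => by simp [cross]
      map_smul' := fun r x => cross_smul_right _ _ _ }
  refine dense_setOf_linearMap_ne_zero L fun h => ?_
  have h' : ∀ x : E3, cross (a : E3) x = 0 := fun x => LinearMap.congr_fun h x
  have e := inner_cross_cross_self (a : E3)
  simp only [h', inner_zero_left, norm_coe_S2, one_pow, one_mul] at e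
  -- If `a × ·` vanished, Lagrange's identity on the basis vectors would make every squared
  -- coordinate of `a` equal to `1`, so `‖a‖² = 3`.
  have hb : ∀ i : Fin 3, (a : E3) i ^ 2 = 1 := fun i => by
    have := e (EuclideanSpace.single i 1)
    simp [EuclideanSpace.inner_single_right] at this
    linarith [this]
  have hn := norm_coe_S2 a
  have h3 : inner ℝ (a : E3) a = 1 := by rw [real_inner_self_eq_norm_sq, hn, one_pow]
  rw [inner_E3] at h3
  linarith [hb 0, hb 1, hb 2, sq ((a : E3) 0), sq ((a : E3) 1), sq ((a : E3) 2)]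

theorem dense_setOf_inner_ne_zero {n : E3} (hn : n ≠ 0) : Dense {u : S2 | inner ℝ n (u : E3) ≠ 0} :=
  dense_setOf_linearMap_ne_zero (innerₗ E3 n) fun h =>
    hn (inner_self_eq_zero (𝕜 := ℝ).1 (LinearMap.congr_fun h n))

/-- Moving one agent alone reduces density in the product to density in one sphere. -/
theorem exists_update_mem {N : ℕ} {U : Set (Conf N)} (hU : IsOpen U) {X : Conf N} (hX : X ∈ U)
    (j : Fin N) {A : Set S2} (hA : Dense A) : ∃ u ∈ A, Function.update X j u ∈ U := by
  have hc : Continuous fun u : S2 => Function.update X j u :=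
    continuous_const.update j continuous_id
  obtain ⟨u, hu, hu'⟩ := hA.inter_open_nonempty _ (hU.preimage hc) ⟨X j, by simpa using hX⟩
  exact ⟨u, hu', hu⟩

theorem continuous_cross {T : Type*} [TopologicalSpace T] {f g : T → E3} (hf : Continuous f)
    (hg : Continuous g) : Continuous fun x => cross (f x) (g x) := by
  have h : ∀ i : Fin 3, Continuous (fun x => f x i) ∧ Continuous fun x => g x i := fun i =>
    ⟨by fun_prop, by fun_prop⟩
  refine (PiLp.continuous_toLp 2 _).comp (continuous_pi fun i => ?_)
  have h0 := h 0
  have h1 := h 1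
  have h2 := h 2
  fin_cases i <;> simp only [cross_apply] <;> simp <;> fun_prop

theorem continuous_coord {N : ℕ} (i : Fin N) : Continuous fun X : Conf N => (X i : E3) :=
  continuous_subtype_val.comp (continuous_apply i)

theorem isDiagonalGSpace_cross_ne_zero {N : ℕ} {i j : Fin N} (hij : j ≠ i) :
    IsDiagonalGSpace {X : Conf N | cross (X i : E3) (X j) ≠ 0} where
  isOpen := isOpen_ne_fun (continuous_cross (continuous_coord i) (continuous_coord j))
    continuous_const
  dense := by
    refine dense_iff_inter_open.2 fun U hU ⟨X, hX⟩ => ?_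
    obtain ⟨u, hu, hu'⟩ := exists_update_mem hU hX j (dense_setOf_cross_ne_zero (X i))
    refine ⟨_, hu', ?_⟩
    simpa [Function.update_of_ne hij.symm] using hu
  invariant g X hX := by
    change cross (rotLin g (X i)) (rotLin g (X j)) ≠ 0
    rw [cross_rotLin, ← norm_ne_zero_iff, norm_rotLin, norm_ne_zero_iff]
    exact hX

theorem isDiagonalGSpace_triple_ne_zero {N : ℕ} {i j k : Fin N} (hji : j ≠ i) (hki : k ≠ i)
    (hjk : j ≠ k) :
    IsDiagonalGSpace {X : Conf N | inner ℝ (X k : E3) (cross (X i : E3) (X j)) ≠ 0} where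
  isOpen := isOpen_ne_fun ((continuous_coord k).inner
    (continuous_cross (continuous_coord i) (continuous_coord j))) continuous_const
  dense := by
    refine dense_iff_inter_open.2 fun U hU hne => ?_
    -- First agents `i` and `j` are made non-collinear, then agent `k` is moved off the plane they
    -- span.
    obtain ⟨X, hX, hX'⟩ := (isDiagonalGSpace_cross_ne_zero hji).dense.inter_open_nonempty U hU hne
    obtain ⟨u, hu, hu'⟩ := exists_update_mem hU hX k (dense_setOf_inner_ne_zero hX')
    refine ⟨_, hu', ?_⟩
    simpa [Function.update_of_ne hki.symm, Function.update_of_ne hjk, real_inner_comm] using hu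
  invariant g X hX := by
    change inner ℝ (rotLin g (X k)) (cross (rotLin g (X i)) (rotLin g (X j))) ≠ 0
    rw [inner_cross_rotLin]
    exact hX

/-! ### Analytic functions of the configuration -/

/-- Charts of the product are products of charts, so in coordinates this is the inclusion of one
sphere preceded by a linear projection. -/
theorem contMDiff_coord {N : ℕ} (i : Fin N) :
    ContMDiff (ModelWithCorners.pi fun _ : Fin N => 𝓡 2) 𝓘(ℝ, E3) ω
      fun X : Conf N => (X i : E3) := by
  intro X
  have h := (contMDiffAt_iff.1 (contMDiff_coe_S2 (m := ω) (X i))).2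
  rw [contMDiffAt_iff]
  refine ⟨(continuous_coord i).continuousAt, ?_⟩
  have hproj : ContDiffWithinAt ℝ ω
      (fun y : Fin N → EuclideanSpace ℝ (Fin 2) => y i)
      (range (ModelWithCorners.pi fun _ : Fin N => 𝓡 2))
      (extChartAt (ModelWithCorners.pi fun _ : Fin N => 𝓡 2) X X) :=
    (contDiff_apply ℝ (EuclideanSpace ℝ (Fin 2)) i).contDiffWithinAt
  exact ContDiffWithinAt.comp (extChartAt (ModelWithCorners.pi fun _ : Fin N => 𝓡 2) X X)
    (t := range (𝓡 2)) h hproj (fun y _ => by simp)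

theorem AnalyticOnConf.proj {N : ℕ} {f : Conf N → Fin N → E3} {D : Set (Conf N)}
    (hf : AnalyticOnConf f D) (i : Fin N) : AnalyticOnConf (fun X => f X i) D :=
  fun X hX => ContDiffAt.comp_contMDiffWithinAt (g := fun v : Fin N → E3 => v i)
    (contDiff_apply ℝ E3 i).contDiffAt (hf X hX)

/-- Composition of an analytic function with the values of an analytic field and the positions of
three agents. -/
theorem AnalyticOnConf.comp_field {N : ℕ} {f : Conf N → E3} {D : Set (Conf N)}
    (hf : AnalyticOnConf f D) (i j k : Fin N) {G : E3 × E3 × E3 × E3 → ℝ}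
    (hG : ∀ X ∈ D, ContDiffAt ℝ ω G (f X, (X i : E3), (X j : E3), (X k : E3))) :
    AnalyticOnConf (fun X => G (f X, (X i : E3), (X j : E3), (X k : E3))) D := by
  intro X hX
  exact ContDiffAt.comp_contMDiffWithinAt (hG X hX) ((hf X hX).prodMk_space
    ((contMDiff_coord i X).contMDiffWithinAt.prodMk_space
      ((contMDiff_coord j X).contMDiffWithinAt.prodMk_space
        (contMDiff_coord k X).contMDiffWithinAt)))

theorem contDiff_inner_cross {T : Type*} [NormedAddCommGroup T] [NormedSpace ℝ T] {f g h : T → E3}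
    (hf : ContDiff ℝ ω f) (hg : ContDiff ℝ ω g) (hh : ContDiff ℝ ω h) :
    ContDiff ℝ ω fun x => inner ℝ (f x) (cross (g x) (h x)) := by
  simp only [inner_E3, cross_apply_zero, cross_apply_one, cross_apply_two]
  have hc : ∀ {u : T → E3} (_ : ContDiff ℝ ω u) (i : Fin 3), ContDiff ℝ ω fun x => u x i :=
    fun hu i => (contDiff_euclidean.1 hu) i
  exact (((hc hf 0).mul (((hc hg 1).mul (hc hh 2)).sub ((hc hg 2).mul (hc hh 1)))).add
    ((hc hf 1).mul (((hc hg 2).mul (hc hh 0)).sub ((hc hg 0).mul (hc hh 2))))).add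
    ((hc hf 2).mul (((hc hg 0).mul (hc hh 1)).sub ((hc hg 1).mul (hc hh 0))))

theorem contDiffAt_sqrt_one_sub_inner_sq {T : Type*} [NormedAddCommGroup T] [NormedSpace ℝ T]
    {f g : T → E3} {x : T} (hf : ContDiff ℝ ω f) (hg : ContDiff ℝ ω g)
    (h : inner ℝ (f x) (g x) ^ 2 < 1) :
    ContDiffAt ℝ ω (fun x => √(1 - inner ℝ (f x) (g x) ^ 2)) x :=
  (contDiff_const.sub ((hf.inner ℝ hg).pow 2)).contDiffAt.sqrt (by linarith)

theorem contDiffAt_inner_div_sqrt {p : E3 × E3 × E3 × E3} (h : inner ℝ p.2.1 p.2.2.1 ^ 2 < 1) :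
    ContDiffAt ℝ ω (fun p : E3 × E3 × E3 × E3 =>
      -(inner ℝ p.1 p.2.2.1 / √(1 - inner ℝ p.2.1 p.2.2.1 ^ 2))) p := by
  have hn : ContDiff ℝ ω fun p : E3 × E3 × E3 × E3 => inner ℝ p.1 p.2.2.1 :=
    contDiff_fst.inner ℝ (by fun_prop)
  have hd := contDiffAt_sqrt_one_sub_inner_sq (f := fun p : E3 × E3 × E3 × E3 => p.2.1)
    (g := fun p => p.2.2.1) (x := p) (by fun_prop) (by fun_prop) h
  exact (hn.contDiffAt.div hd (Real.sqrt_pos.2 (sub_pos.2 h)).ne').neg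

theorem contDiffAt_inner_cross_div_sqrt {p : E3 × E3 × E3 × E3}
    (h : inner ℝ p.2.1 p.2.2.1 ^ 2 < 1) :
    ContDiffAt ℝ ω (fun p : E3 × E3 × E3 × E3 =>
      -(inner ℝ p.1 (cross p.2.1 p.2.2.1) / √(1 - inner ℝ p.2.1 p.2.2.1 ^ 2))) p := by
  have hn : ContDiff ℝ ω fun p : E3 × E3 × E3 × E3 => inner ℝ p.1 (cross p.2.1 p.2.2.1) :=
    contDiff_inner_cross contDiff_fst (by fun_prop) (by fun_prop)
  have hd := contDiffAt_sqrt_one_sub_inner_sq (f := fun p : E3 × E3 × E3 × E3 => p.2.1)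
    (g := fun p => p.2.2.1) (x := p) (by fun_prop) (by fun_prop) h
  exact (hn.contDiffAt.div hd (Real.sqrt_pos.2 (sub_pos.2 h)).ne').neg

/-- The free slots `u` and `w` let one statement serve both coefficients of a decomposition along
two gradients. -/
theorem contDiffAt_inner_cross_mul_sqrt_div {u w : E3 × E3 × E3 × E3 → E3}
    (hu : ContDiff ℝ ω u) (hw : ContDiff ℝ ω w) {p : E3 × E3 × E3 × E3}
    (h : inner ℝ p.2.1 (u p) ^ 2 < 1) (h' : inner ℝ p.2.2.2 (cross p.2.1 p.2.2.1) ≠ 0) :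
    ContDiffAt ℝ ω (fun p : E3 × E3 × E3 × E3 => inner ℝ p.1 (cross p.2.1 (w p)) *
      √(1 - inner ℝ p.2.1 (u p) ^ 2) / inner ℝ p.2.2.2 (cross p.2.1 p.2.2.1)) p := by
  have hn : ContDiff ℝ ω fun p : E3 × E3 × E3 × E3 => inner ℝ p.1 (cross p.2.1 (w p)) :=
    contDiff_inner_cross contDiff_fst (by fun_prop) hw
  have hd : ContDiff ℝ ω fun p : E3 × E3 × E3 × E3 => inner ℝ p.2.2.2 (cross p.2.1 p.2.2.1) :=
    contDiff_inner_cross (by fun_prop) (by fun_prop) (by fun_prop)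
  have hs := contDiffAt_sqrt_one_sub_inner_sq (f := fun p : E3 × E3 × E3 × E3 => p.2.1)
    (g := u) (x := p) (by fun_prop) hu h
  exact (hn.contDiffAt.mul hs).div hd.contDiffAt h'

/-! ### Decomposition of tangent vectors -/

theorem cross_left_ne_zero_of_triple {a b c : E3} (h : inner ℝ c (cross a b) ≠ 0) :
    cross a b ≠ 0 := fun h' => h (by rw [h', inner_zero_right])

theorem cross_right_ne_zero_of_triple {a b c : E3} (h : inner ℝ c (cross a b) ≠ 0) :
    cross a c ≠ 0 := fun h' => h (by rw [inner_cross_swap, h', inner_zero_right, neg_zero])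

theorem cross_distGradient (a b : E3) :
    cross a (distGradient a b) = -(√(1 - inner ℝ a b ^ 2))⁻¹ • cross a b := by
  rw [distGradient, cross_smul_right, cross_sub_right, cross_smul_right, cross_self_E3, smul_zero,
    sub_zero]

theorem inner_distGradient_cross (a b c : E3) :
    inner ℝ (distGradient a b) (cross a c) =
      -(√(1 - inner ℝ a b ^ 2))⁻¹ * inner ℝ b (cross a c) := by
  rw [distGradient, real_inner_smul_left, inner_sub_left, real_inner_smul_left,
    inner_cross_self_left, mul_zero, sub_zero]

theorem inner_distGradient_right (a b : S2) :
    inner ℝ (distGradient a b) (b : E3) =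
      -(√(1 - inner ℝ (a : E3) b ^ 2))⁻¹ * (1 - inner ℝ (a : E3) b ^ 2) := by
  rw [distGradient, real_inner_smul_left, inner_sub_left, real_inner_smul_left,
    real_inner_self_eq_norm_sq, norm_coe_S2]
  ring

/-- Both sides have the same inner products with `a`, `b` and `a × b`, whose triple product is `‖a ×
b‖²`. -/
theorem eq_distGradient_add_cross {a b : S2} (hab : cross (a : E3) b ≠ 0) {v : E3}
    (hv : inner ℝ (a : E3) v = 0) :
    v = (-(inner ℝ v (b : E3) / √(1 - inner ℝ (a : E3) b ^ 2))) • distGradient a b +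
      (-(inner ℝ v (cross (a : E3) b) / √(1 - inner ℝ (a : E3) b ^ 2))) •
        cross a (distGradient a b) := by
  have hlt := inner_sq_lt_one_iff.2 hab
  have hs : √(1 - inner ℝ (a : E3) b ^ 2) ≠ 0 := (Real.sqrt_pos.2 (sub_pos.2 hlt)).ne'
  have hsq : √(1 - inner ℝ (a : E3) b ^ 2) ^ 2 = 1 - inner ℝ (a : E3) b ^ 2 :=
    Real.sq_sqrt (sub_pos.2 hlt).le
  have hcc : inner ℝ (cross (a : E3) b) (cross (a : E3) b) = √(1 - inner ℝ (a : E3) b ^ 2) ^ 2 := by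
    rw [inner_cross_cross_self, norm_coe_S2, norm_coe_S2, hsq]; ring
  refine sub_eq_zero.1 (eq_zero_of_inner_eq_zero (a := a) (b := b) (c := cross a b) ?_ ?_ ?_ ?_)
  · rw [hcc]; exact pow_ne_zero 2 hs
  · rw [cross_distGradient, inner_sub_left, inner_add_left, real_inner_smul_left,
      real_inner_smul_left, real_inner_smul_left, real_inner_comm (a : E3) v, hv,
      real_inner_comm (a : E3) (distGradient a b), inner_distGradient_self,
      real_inner_comm (a : E3) (cross a b), inner_cross_self_left]
    ring
  · rw [cross_distGradient, inner_sub_left, inner_add_left, real_inner_smul_left,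
      real_inner_smul_left, real_inner_smul_left, inner_distGradient_right,
      real_inner_comm (b : E3) (cross _ _), inner_cross_self_right]
    field_simp
    rw [hsq]
    ring
  · rw [cross_distGradient, inner_sub_left, inner_add_left, real_inner_smul_left,
      real_inner_smul_left, real_inner_smul_left, inner_distGradient_cross,
      inner_cross_self_right, hcc]
    field_simp
    ring

/-- The gradient towards `b` is orthogonal to `a × b`, and that towards `c` to `a × c`; pairing `v`
with either cross product thus isolates the coefficient of the other gradient. -/
theorem eq_distGradient_add_distGradient {a b c : S2}
    (habc : inner ℝ (c : E3) (cross (a : E3) b) ≠ 0) {v : E3} (hv : inner ℝ (a : E3) v = 0) :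
    v = (inner ℝ v (cross (a : E3) c) * √(1 - inner ℝ (a : E3) b ^ 2) /
        inner ℝ (c : E3) (cross (a : E3) b)) • distGradient a b +
      (-(inner ℝ v (cross (a : E3) b) * √(1 - inner ℝ (a : E3) c ^ 2) /
        inner ℝ (c : E3) (cross (a : E3) b))) • distGradient a c := by
  have hs : √(1 - inner ℝ (a : E3) b ^ 2) ≠ 0 := (Real.sqrt_pos.2 (sub_pos.2
    (inner_sq_lt_one_iff.2 (cross_left_ne_zero_of_triple habc)))).ne'
  have hs' : √(1 - inner ℝ (a : E3) c ^ 2) ≠ 0 := (Real.sqrt_pos.2 (sub_pos.2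
    (inner_sq_lt_one_iff.2 (cross_right_ne_zero_of_triple habc)))).ne'
  refine sub_eq_zero.1
    (eq_zero_of_inner_eq_zero (a := a) (b := cross a b) (c := cross a c) ?_ ?_ ?_ ?_)
  · rw [inner_cross_cross_cross, norm_coe_S2, one_pow, one_mul]
    exact habc
  · rw [real_inner_comm, inner_sub_right, inner_add_right, real_inner_smul_right,
      real_inner_smul_right, hv, inner_distGradient_self, inner_distGradient_self]
    ring
  · rw [inner_sub_left, inner_add_left, real_inner_smul_left, real_inner_smul_left,
      inner_distGradient_cross, inner_distGradient_cross, inner_cross_self_right]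
    field_simp
    ring
  · rw [inner_sub_left, inner_add_left, real_inner_smul_left, real_inner_smul_left,
      inner_distGradient_cross, inner_distGradient_cross, inner_cross_self_right,
      inner_cross_swap (a : E3) b c]
    field_simp
    ring

/-! ### Equivariant fields -/

namespace ConfVectorField

variable {N : ℕ}

theorem continuousOn_apply (F : ConfVectorField N) (i : Fin N) :
    ContinuousOn (fun X => F.toFun X i) F.dom :=
  (F.analytic.proj i).continuousOn

/-- Equivariance of a component extends from a diagonal space to the whole domain. -/
theorem equivariant_of_inter (F : ConfVectorField N) {S : Set (Conf N)} (hS : IsDiagonalGSpace S)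
    {i : Fin N} {g : SO3}
    (h : ∀ X ∈ F.dom ∩ S, F.toFun (diagRot g X) i = rotLin g (F.toFun X i)) :
    ∀ X ∈ F.dom, F.toFun (diagRot g X) i = rotLin g (F.toFun X i) := by
  have hl : ContinuousOn (fun X => F.toFun (diagRot g X) i) F.dom :=
    (F.continuousOn_apply i).comp (continuous_diagRot g).continuousOn
      fun X hX => F.isDiagonalGSpace.invariant g X hX
  have hr : ContinuousOn (fun X => rotLin g (F.toFun X i)) F.dom :=
    (rotLin g).continuous_of_finiteDimensional.comp_continuousOn (F.continuousOn_apply i)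
  refine Set.EqOn.of_subset_closure h hl hr inter_subset_left ?_
  rw [(F.isDiagonalGSpace.inter hS).dense.closure_eq]
  exact subset_univ _

/-- The null field is the only equivariant field for one agent. -/
theorem isPopulationDynamics_one_iff (F : ConfVectorField 1) :
    F.IsPopulationDynamics ↔ F.dom = Set.univ ∧ ∀ X i, F.toFun X i = 0 := by
  constructor
  · rintro ⟨hF, -⟩
    have huniv : F.dom = Set.univ := by
      -- The domain is dense, so it contains a point not antipodal to `Y`; a rotation carries that
      -- point to `Y`.
      refine eq_univ_of_forall fun Y => ?_
      have hopen : IsOpen {X : Conf 1 | (X 0 : E3) + Y 0 ≠ 0} :=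
        isOpen_ne_fun ((continuous_coord 0).add continuous_const) continuous_const
      have hne : (Y 0 : E3) + Y 0 ≠ 0 := by
        rw [← two_smul ℝ]
        refine smul_ne_zero two_ne_zero (norm_ne_zero_iff.1 ?_)
        rw [norm_coe_S2]; exact one_ne_zero
      obtain ⟨X, hX, hXd⟩ := F.isDiagonalGSpace.dense.inter_open_nonempty _ hopen ⟨Y, hne⟩
      obtain ⟨g, hg⟩ := exists_rot_eq hX
      have hY : diagRot g X = Y := by
        funext i
        rw [Subsingleton.elim i 0]
        exact hg
      exact hY ▸ F.isDiagonalGSpace.invariant g X hXd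
    refine ⟨huniv, fun X i => ?_⟩
    have hX : X ∈ F.dom := huniv ▸ mem_univ X
    obtain ⟨g, hg⟩ := exists_halfTurn (X i)
    have hfix : diagRot g X = X := by
      funext j
      rw [Subsingleton.elim j i]
      refine Subtype.ext ?_
      change rotLin g (X i) = X i
      rw [hg, real_inner_self_eq_norm_sq, norm_coe_S2, one_pow, mul_one, two_smul,
        add_sub_cancel_right]
    have h := hF g X hX i
    -- The half turn about `X i` acts as `-1` on tangent vectors, so equivariance reads `F = -F`.
    rw [hfix, hg, F.tangent X hX, mul_zero, zero_smul, zero_sub] at h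
    have h2 : (2 : ℝ) • F.toFun X i = 0 := by
      rw [two_smul]
      nth_rw 1 [h]
      exact neg_add_cancel _
    exact (smul_eq_zero.1 h2).resolve_left two_ne_zero
  · rintro ⟨hu, h0⟩
    refine ⟨fun g X _ i => by rw [h0, h0, map_zero], ?_⟩
    rintro ⟨F', hF', -⟩
    rw [hu] at hF'
    exact hF'.2 (subset_univ _)

/-- The jointly radial function given by an invariant analytic expression in the `i`-th component of
an equivariant field and the positions of the agents `i`, `j`, `k`. -/
def radialOfInvariant {F : ConfVectorField N} (hF : F.IsEquivariant) (i j k : Fin N)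
    {S : Set (Conf N)} (hS : IsDiagonalGSpace S) (G : E3 × E3 × E3 × E3 → ℝ)
    (hG : ∀ v : E3, ∀ X ∈ S, ContDiffAt ℝ ω G (v, (X i : E3), (X j : E3), (X k : E3)))
    (hinv : ∀ (g : SO3) (v a b c : E3),
      G (rotLin g v, rotLin g a, rotLin g b, rotLin g c) = G (v, a, b, c)) :
    JointlyRadial N where
  dom := F.dom ∩ S
  toFun X := G (F.toFun X i, (X i : E3), (X j : E3), (X k : E3))
  isDiagonalGSpace := F.isDiagonalGSpace.inter hS
  analytic := AnalyticOnConf.comp_field (f := fun X => F.toFun X i)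
    (ContMDiffOn.mono (F.analytic.proj i) inter_subset_left) i j k fun X hX => hG _ X hX.2
  radial g X hX := by
    rw [hF g X hX.1 i]
    exact hinv g _ _ _ _

theorem exists_radial_pair {F : ConfVectorField N} (hF : F.IsEquivariant) {i j : Fin N}
    (hij : j ≠ i) : ∃ φ₁ φ₂ : JointlyRadial N, ∀ X ∈ F.dom ∩ φ₁.dom ∩ φ₂.dom, ∃ h : E3,
      IsDistGradient (X i) (X j) h ∧
        F.toFun X i = φ₁.toFun X • h + φ₂.toFun X • perp (X i) h := by
  have hS := isDiagonalGSpace_cross_ne_zero hij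
  -- Only two agents occur in the coefficients; the slot of the third repeats `j`.
  let φ₁ := radialOfInvariant hF i j j hS
    (fun p => -(inner ℝ p.1 p.2.2.1 / √(1 - inner ℝ p.2.1 p.2.2.1 ^ 2)))
    (fun v X hX => contDiffAt_inner_div_sqrt (p := (v, (X i : E3), (X j : E3), (X j : E3)))
      (inner_sq_lt_one_iff.2 hX))
    (fun g v a b c => by simp only [inner_rotLin])
  let φ₂ := radialOfInvariant hF i j j hS
    (fun p => -(inner ℝ p.1 (cross p.2.1 p.2.2.1) / √(1 - inner ℝ p.2.1 p.2.2.1 ^ 2)))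
    (fun v X hX => contDiffAt_inner_cross_div_sqrt (p := (v, (X i : E3), (X j : E3), (X j : E3)))
      (inner_sq_lt_one_iff.2 hX))
    (fun g v a b c => by simp only [inner_rotLin, inner_cross_rotLin])
  refine ⟨φ₁, φ₂, fun X hX => ?_⟩
  have hX' : cross (X i : E3) (X j) ≠ 0 := hX.1.2.2
  exact ⟨distGradient (X i) (X j), (isDistGradient_iff (inner_sq_lt_one_iff.2 hX') _).2 rfl,
    eq_distGradient_add_cross hX' (F.tangent X hX.1.1 i)⟩

theorem exists_radial_triple {F : ConfVectorField N} (hF : F.IsEquivariant) {i j k : Fin N}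
    (hji : j ≠ i) (hki : k ≠ i) (hjk : j ≠ k) :
    ∃ φ₁ φ₂ : JointlyRadial N, ∀ X ∈ F.dom ∩ φ₁.dom ∩ φ₂.dom, ∃ h₂ h₃ : E3,
      IsDistGradient (X i) (X j) h₂ ∧ IsDistGradient (X i) (X k) h₃ ∧
        F.toFun X i = φ₁.toFun X • h₂ + φ₂.toFun X • h₃ := by
  have hS := isDiagonalGSpace_triple_ne_zero hji hki hjk
  let φ₁ := radialOfInvariant hF i j k hS
    (fun p => inner ℝ p.1 (cross p.2.1 p.2.2.2) * √(1 - inner ℝ p.2.1 p.2.2.1 ^ 2) /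
      inner ℝ p.2.2.2 (cross p.2.1 p.2.2.1))
    (fun v X hX => contDiffAt_inner_cross_mul_sqrt_div (u := fun p => p.2.2.1)
      (w := fun p => p.2.2.2) (p := (v, (X i : E3), (X j : E3), (X k : E3)))
      (by fun_prop) (by fun_prop) (inner_sq_lt_one_iff.2 (cross_left_ne_zero_of_triple hX)) hX)
    (fun g v a b c => by simp only [inner_rotLin, inner_cross_rotLin])
  let φ₂ := radialOfInvariant hF i j k hS
    (fun p => -(inner ℝ p.1 (cross p.2.1 p.2.2.1) * √(1 - inner ℝ p.2.1 p.2.2.2 ^ 2) /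
      inner ℝ p.2.2.2 (cross p.2.1 p.2.2.1)))
    (fun v X hX => (contDiffAt_inner_cross_mul_sqrt_div (u := fun p => p.2.2.2)
      (w := fun p => p.2.2.1) (p := (v, (X i : E3), (X j : E3), (X k : E3)))
      (by fun_prop) (by fun_prop)
      (inner_sq_lt_one_iff.2 (cross_right_ne_zero_of_triple hX)) hX).neg)
    (fun g v a b c => by simp only [inner_rotLin, inner_cross_rotLin])
  refine ⟨φ₁, φ₂, fun X hX => ?_⟩
  have hX' : inner ℝ (X k : E3) (cross (X i : E3) (X j)) ≠ 0 := hX.1.2.2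
  exact ⟨distGradient (X i) (X j), distGradient (X i) (X k),
    (isDistGradient_iff (inner_sq_lt_one_iff.2 (cross_left_ne_zero_of_triple hX')) _).2 rfl,
    (isDistGradient_iff (inner_sq_lt_one_iff.2 (cross_right_ne_zero_of_triple hX')) _).2 rfl,
    eq_distGradient_add_distGradient hX' (F.tangent X hX.1.1 i)⟩

theorem isEquivariant_of_radial_pair {F : ConfVectorField N} {i j : Fin N}
    (hij : j ≠ i) {φ₁ φ₂ : JointlyRadial N} (h : ∀ X ∈ F.dom ∩ φ₁.dom ∩ φ₂.dom, ∃ h : E3,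
      IsDistGradient (X i) (X j) h ∧
        F.toFun X i = φ₁.toFun X • h + φ₂.toFun X • perp (X i) h) (g : SO3) :
    ∀ X ∈ F.dom, F.toFun (diagRot g X) i = rotLin g (F.toFun X i) := by
  -- Restricting to non-collinear pairs, still a dense set, identifies the given gradient with
  -- `distGradient` and makes its equivariance available.
  have hS := (φ₁.isDiagonalGSpace.inter φ₂.isDiagonalGSpace).inter
    (isDiagonalGSpace_cross_ne_zero hij)
  have key : ∀ X ∈ F.dom ∩ (φ₁.dom ∩ φ₂.dom ∩ {X : Conf N | cross (X i : E3) (X j) ≠ 0}),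
      F.toFun X i = φ₁.toFun X • distGradient (X i) (X j) +
        φ₂.toFun X • cross (X i) (distGradient (X i) (X j)) := by
    rintro X ⟨hX, ⟨h₁, h₂⟩, h₃⟩
    obtain ⟨v, hv, hF⟩ := h X ⟨⟨hX, h₁⟩, h₂⟩
    rw [hF, perp_eq_cross, (isDistGradient_iff (inner_sq_lt_one_iff.2 h₃) v).1 hv]
  refine F.equivariant_of_inter hS fun X hX => ?_
  rw [key X hX, key _ ((F.isDiagonalGSpace.inter hS).invariant g X hX), φ₁.radial g X hX.2.1.1,
    φ₂.radial g X hX.2.1.2]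
  simp only [diagRot, coe_rot, distGradient_rotLin, cross_rotLin, map_add, map_smul]

/-- Each gradient is equivariant by itself, so linear independence of the two plays no role in this
direction. -/
theorem isEquivariant_of_radial_triple {F : ConfVectorField N} {i j k : Fin N}
    (hji : j ≠ i) (hki : k ≠ i) {φ₁ φ₂ : JointlyRadial N}
    (h : ∀ X ∈ F.dom ∩ φ₁.dom ∩ φ₂.dom, ∃ h₂ h₃ : E3,
      IsDistGradient (X i) (X j) h₂ ∧ IsDistGradient (X i) (X k) h₃ ∧
        F.toFun X i = φ₁.toFun X • h₂ + φ₂.toFun X • h₃) (g : SO3) :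
    ∀ X ∈ F.dom, F.toFun (diagRot g X) i = rotLin g (F.toFun X i) := by
  have hS := (φ₁.isDiagonalGSpace.inter φ₂.isDiagonalGSpace).inter
    ((isDiagonalGSpace_cross_ne_zero hji).inter (isDiagonalGSpace_cross_ne_zero hki))
  have key : ∀ X ∈ F.dom ∩ (φ₁.dom ∩ φ₂.dom ∩ ({X : Conf N | cross (X i : E3) (X j) ≠ 0} ∩
      {X : Conf N | cross (X i : E3) (X k) ≠ 0})),
      F.toFun X i = φ₁.toFun X • distGradient (X i) (X j) +
        φ₂.toFun X • distGradient (X i) (X k) := by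
    rintro X ⟨hX, ⟨h₁, h₂⟩, h₃, h₄⟩
    obtain ⟨v, w, hv, hw, hF⟩ := h X ⟨⟨hX, h₁⟩, h₂⟩
    rw [hF, (isDistGradient_iff (inner_sq_lt_one_iff.2 h₃) v).1 hv,
      (isDistGradient_iff (inner_sq_lt_one_iff.2 h₄) w).1 hw]
  refine F.equivariant_of_inter hS fun X hX => ?_
  rw [key X hX, key _ ((F.isDiagonalGSpace.inter hS).invariant g X hX), φ₁.radial g X hX.2.1.1,
    φ₂.radial g X hX.2.1.2]
  simp only [diagRot, coe_rot, distGradient_rotLin, map_add, map_smul]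

end ConfVectorField

end SphereDynamics

end

/-! ### Assembly for one, two and at least three agents -/

theorem proposition5p2 :
    -- one agent: the only population dynamics is the null vector field
    (∀ F : SphereDynamics.ConfVectorField 1,
      F.IsPopulationDynamics ↔ F.dom = Set.univ ∧ ∀ X i, F.toFun X i = 0) ∧
    -- two agents
    (∀ F : SphereDynamics.ConfVectorField 2,
      F.IsPopulationDynamics ↔ F.HasMaximalDomain ∧
        ∀ i j : Fin 2, i ≠ j → ∃ φ₁ φ₂ : SphereDynamics.JointlyRadial 2,
          ∀ X ∈ F.dom ∩ φ₁.dom ∩ φ₂.dom, ∃ h : SphereDynamics.E3,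
            SphereDynamics.IsDistGradient (X i) (X j) h ∧
            F.toFun X i = φ₁.toFun X • h + φ₂.toFun X • SphereDynamics.perp (X i) h) ∧
    -- at least three agents; the triple of distinct indices of agent `i` is `(i, k₂ i, k₃ i)`
    (∀ N : ℕ, 3 ≤ N → ∀ k₂ k₃ : Fin N → Fin N,
      (∀ i, k₂ i ≠ i ∧ k₃ i ≠ i ∧ k₂ i ≠ k₃ i) →
      ∀ F : SphereDynamics.ConfVectorField N,
        F.IsPopulationDynamics ↔ F.HasMaximalDomain ∧
          ∀ i : Fin N, ∃ φ₁ φ₂ : SphereDynamics.JointlyRadial N,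
            ∀ X ∈ F.dom ∩ φ₁.dom ∩ φ₂.dom, ∃ h₂ h₃ : SphereDynamics.E3,
              SphereDynamics.IsDistGradient (X i) (X (k₂ i)) h₂ ∧
              SphereDynamics.IsDistGradient (X i) (X (k₃ i)) h₃ ∧
              F.toFun X i = φ₁.toFun X • h₂ + φ₂.toFun X • h₃) := by
  refine ⟨fun F => F.isPopulationDynamics_one_iff, fun F => ?_, fun N _ k₂ k₃ hk F => ?_⟩
  · constructor
    · rintro ⟨hF, hmax⟩
      exact ⟨hmax, fun i j hij => SphereDynamics.ConfVectorField.exists_radial_pair hF hij.symm⟩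
    · rintro ⟨hmax, h⟩
      refine ⟨fun g X hX i => ?_, hmax⟩
      obtain ⟨j, hj⟩ := exists_ne i
      obtain ⟨φ₁, φ₂, hφ⟩ := h i j hj.symm
      exact SphereDynamics.ConfVectorField.isEquivariant_of_radial_pair hj hφ g X hX
  · constructor
    · rintro ⟨hF, hmax⟩
      exact ⟨hmax, fun i => SphereDynamics.ConfVectorField.exists_radial_triple hF
        (hk i).1 (hk i).2.1 (hk i).2.2⟩
    · rintro ⟨hmax, h⟩
      refine ⟨fun g X hX i => ?_, hmax⟩
      obtain ⟨φ₁, φ₂, hφ⟩ := h i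
      exact SphereDynamics.ConfVectorField.isEquivariant_of_radial_triple
        (hk i).1 (hk i).2.1 hφ g X hX
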